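/- Let $R$ be an associative ring with identity, not necessarily commutative, and let $J(R)$ be its Jacobson radical. An element of $R$ is called uniquely clean if it can be written in exactly one way as $e+u$ with $e=e^2\in R$ and $u$ a unit of $R$. The ring $R$ is called uniquely $\pi$-clean if for every $a\in R$ there is an integer $n\ge 1$ such that $a^n$ is uniquely clean. Then $R$ is uniquely $\pi$-clean if and only if the following three conditions hold: (1) $R$ is abelian, that is, every idempotent of $R$ is central; (2) idempotents lift modulo $J(R)$, that is, every idempotent of $R/J(R)$ is the image of an idempotent of $R$; (3) for every prime ideal $P$ of $R$ with $J(R)\subseteq P$, the ring $R/P$ is torsion, that is, for every nonzero $x\in R/P$ there is an integer $m\ge 1$ with $x^m=1$. Here a prime ideal is a proper two-sided ideal $P$ such that, for all two-sided ideals $K,L$ of $R$, $KL\subseteq P$ implies $K\subseteq P$ or $L\subseteq P$. -/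

import Mathlib

/-- An element of a ring is uniquely clean if it can be written in exactly one way as
`e + u` with `e` an idempotent and `u` a unit. -/
def IsUniquelyCleanElem {R : Type*} [Ring R] (a : R) : Prop :=
  ∃! p : R × R, IsIdempotentElem p.1 ∧ IsUnit p.2 ∧ a = p.1 + p.2

/-- A ring is uniquely `π`-clean if every element has a positive power which is uniquely clean. -/
def IsUniquelyPiCleanRing (R : Type*) [Ring R] : Prop :=
  ∀ a : R, ∃ n : ℕ, 0 < n ∧ IsUniquelyCleanElem (a ^ n)

/-- A ring is abelian if all its idempotents are central. -/
def IsAbelianRing (R : Type*) [Ring R] : Prop :=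
  ∀ e : R, IsIdempotentElem e → ∀ r : R, e * r = r * e

/-- Every idempotent of `R ⧸ I` is the image of an idempotent of `R`. -/
def IdempotentsLiftModulo {R : Type*} [Ring R] (I : Ideal R) [I.IsTwoSided] : Prop :=
  ∀ x : R ⧸ I, IsIdempotentElem x → ∃ e : R, IsIdempotentElem e ∧ Ideal.Quotient.mk I e = x

/-- Prime ideals of a possibly noncommutative ring: proper two-sided ideals `P` such that
`K * L ⊆ P` implies `K ⊆ P` or `L ⊆ P`, for two-sided ideals `K` and `L`. (Mathlib's
`Ideal.IsPrime` is the elementwise condition, which is stronger, that is, complete primeness.) -/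
structure IsPrimeTwoSidedIdeal {R : Type*} [Ring R] (P : Ideal R) : Prop where
  isTwoSided : P.IsTwoSided
  ne_top : P ≠ ⊤
  le_or_le : ∀ K L : Ideal R, K.IsTwoSided → L.IsTwoSided → K * L ≤ P → K ≤ P ∨ L ≤ P

/-- A ring is torsion if every nonzero element is a root of unity. -/
def IsTorsionRing (R : Type*) [Ring R] : Prop :=
  ∀ x : R, x ≠ 0 → ∃ m : ℕ, 0 < m ∧ x ^ m = 1

/-!
Work modulo the Jacobson radical `J`. In an abelian ring every idempotent splits the ring as a
product of two corners, and if a power `x` of an element is `x = e + u`, then `x` is a unit on the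
corner of `1 - e`, while `x - 1` is a unit on the corner of `e`.

Suppose first that `R` is uniquely `π`-clean. An idempotent `e` is then itself uniquely clean, and
comparing `e = (1 - e) + (2 e - 1)` with the decompositions obtained from the idempotents
`e + e r (1 - e)` and `e + (1 - e) r e` forces `e` to be central. The decomposition of a power of
`a` lifts the class of `a` whenever that class is idempotent. The key consequence of uniqueness
is that each unit `v` has a power `v ^ n ∈ 1 + J`: otherwise `v ^ n - 1` would be invertible on some
nonzero corner `f`, and then `v ^ n - f` would be a second unit
(`sub_one_mem_jacobson_of_isUniquelyCleanElem`, based on the criterion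
`mem_jacobson_of_forall_corner`). Hence in `R ⧸ J` every element is a root of a monic polynomial
`(X ^ (n k) - 1) ((X ^ n - 1) ^ k - 1)` over `ℤ`, and evaluating the one for `3` shows that
`R ⧸ J` has positive characteristic. So each element generates a finite subring; as `R ⧸ J` is
reduced, it satisfies `a = a ^ (d + 1)` with `d > 0`. The idempotent `a ^ d` lifts to a central
idempotent, which a prime ideal sends to `0` or `1`; thus `a = 0` or `a ^ d = 1` modulo the prime.

Conversely, the exponents at the various primes have to be made uniform. If no power of
`a ^ (d + 1) - a`, for any `d > 0`, were in `J`, an ideal maximal with this property would be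
prime, since `a ^ (d + 1) - a` divides `a ^ (d d' + 1) - a`; but its quotient is torsion, which is
absurd. As `J` is an intersection of primitive, hence prime, ideals with reduced quotients, one gets
`a ^ (d + 1) - a ∈ J` itself. Then `a ^ d` is idempotent modulo `J`, and lifting this idempotent
gives the clean decomposition of `a ^ d`. It is unique because, in an abelian ring, the idempotent
of such a decomposition is determined modulo `J`, and congruent central idempotents are equal.
-/

/-! ### The Jacobson radical of a noncommutative ring -/

theorem mem_ring_jacobson_iff {R : Type*} [Ring R] {x : R} :
    x ∈ Ring.jacobson R ↔ ∀ y, ∃ z, z * (y * x + 1) = 1 := by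
  rw [← Ideal.jacobson_bot, Ideal.mem_jacobson_iff]
  simp [mul_add, sub_eq_zero, mul_assoc]

theorem isUnit_one_add_of_mem_jacobson {R : Type*} [Ring R] {x : R}
    (hx : x ∈ Ring.jacobson R) : IsUnit (1 + x) := by
  obtain ⟨z, hz⟩ := mem_ring_jacobson_iff.1 hx 1
  -- The left inverse `z = 1 - z x` is itself left invertible, because `z - 1` is in the radical.
  obtain ⟨w, hw⟩ := mem_ring_jacobson_iff.1 hx (-z)
  have hz' : z * (1 + x) = 1 := by simpa [add_comm] using hz
  have hw' : w * z = 1 := by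
    have : -z * x + 1 = z := by
      rw [mul_add, mul_one] at hz'
      rw [neg_mul, ← hz']; abel
    rwa [this] at hw
  have : w = 1 + x := by
    calc w = w * (z * (1 + x)) := by rw [hz', mul_one]
      _ = 1 + x := by rw [← mul_assoc, hw', one_mul]
  exact isUnit_iff_exists.2 ⟨z, this ▸ hw', hz'⟩

theorem IsUnit.add_mem_jacobson {R : Type*} [Ring R] {u x : R} (hu : IsUnit u)
    (hx : x ∈ Ring.jacobson R) : IsUnit (u + x) := by
  obtain ⟨u, rfl⟩ := hu
  have h := isUnit_one_add_of_mem_jacobson (Ideal.mul_mem_left _ (↑u⁻¹ : R) hx)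
  have : (u : R) + x = u * (1 + ↑u⁻¹ * x) := by simp [mul_add]
  rw [this]
  exact u.isUnit.mul h

theorem IsIdempotentElem.eq_zero_of_mem_jacobson {R : Type*} [Ring R] {e : R}
    (he : IsIdempotentElem e) (hx : e ∈ Ring.jacobson R) : e = 0 := by
  have h := isUnit_one_add_of_mem_jacobson (Ideal.neg_mem_iff _ |>.2 hx)
  apply h.mul_left_cancel
  rw [mul_zero, add_mul, neg_mul, he.eq]; simp

/-! ### Abelian rings -/

theorem IsIdempotentElem.isUnit_two_mul_sub_one {R : Type*} [Ring R] {e : R}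
    (he : IsIdempotentElem e) : IsUnit (2 * e - 1) := by
  have : (2 * e - 1) * (2 * e - 1) = 1 := by
    have : (2 * e - 1) * (2 * e - 1) = 4 * (e * e) - 4 * e + 1 := by noncomm_ring
    rw [this, he.eq]; simp
  exact isUnit_iff_exists.2 ⟨_, this, this⟩

theorem IsAbelianRing.eq_of_sub_mem_jacobson {R : Type*} [Ring R] (hR : IsAbelianRing R)
    {e f : R} (he : IsIdempotentElem e) (hf : IsIdempotentElem f)
    (h : e - f ∈ Ring.jacobson R) : e = f := by
  have key : ∀ {e f : R}, IsIdempotentElem e → IsIdempotentElem f →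
      e - f ∈ Ring.jacobson R → e = e * f := by
    intro e f he hf h
    have h1 : e * (1 - f) = (e - f) * (1 - f) := by rw [sub_mul, hf.mul_one_sub_self, sub_zero]
    have h2 : e * (1 - f) ∈ Ring.jacobson R := h1 ▸ Ideal.mul_mem_right _ _ h
    have h3 := (he.mul_of_commute (hR e he (1 - f)) hf.one_sub).eq_zero_of_mem_jacobson h2
    rwa [mul_sub, mul_one, sub_eq_zero] at h3
  rw [key he hf h, hR e he, ← key hf he (by rw [← neg_sub]; exact neg_mem h)]

/-- Abelian rings are Dedekind finite, on every corner: one-sided inverses are two-sided. -/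
theorem IsAbelianRing.mul_mul_eq_of_mul_mul_eq {R : Type*} [Ring R] (hR : IsAbelianRing R)
    {f x y : R} (hf : IsIdempotentElem f) (h : y * x * f = f) : x * y * f = f := by
  have hg : IsIdempotentElem (x * y * f) := by
    calc x * y * f * (x * y * f) = x * (y * (f * x)) * y * f := by noncomm_ring
      _ = x * (y * x * f) * y * f := by rw [hR f hf x]; noncomm_ring
      _ = x * (f * y) * f := by rw [h]; noncomm_ring
      _ = x * y * (f * f) := by rw [hR f hf y]; noncomm_ring
      _ = x * y * f := by rw [hf.eq]
  -- The idempotent `x y f` is central, so it moves inside `f = (y x f) (y x f)`.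
  symm
  calc f = y * x * f * (y * x * f) := by rw [h, hf.eq]
    _ = y * x * (f * y) * x * f := by noncomm_ring
    _ = y * (x * y * f) * x * f := by rw [hR f hf y]; noncomm_ring
    _ = x * y * f * (y * x * f) := by rw [← hR _ hg y]; noncomm_ring
    _ = x * y * f := by rw [h, mul_assoc, hf.eq]

/-- If an idempotent `x` is clean, `x = e + u`, with `e` central, then `e` has to be `1 - x`. -/
theorem IsIdempotentElem.eq_one_sub_of_eq_add {R : Type*} [Ring R] {x e u : R}
    (hx : IsIdempotentElem x) (he : IsIdempotentElem e) (hc : ∀ r, e * r = r * e)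
    (hu : IsUnit u) (h : x = e + u) : x = 1 - e := by
  have hu' : u = x - e := by rw [h]; abel
  have h1 : x * e = 0 := by
    apply hu.mul_left_eq_zero.1
    calc x * e * u = x * x * e - x * (e * e) := by rw [hu', mul_sub, mul_assoc, hc x]; noncomm_ring
      _ = 0 := by rw [hx.eq, he.eq, sub_self]
  have h2 : (1 - x) * (1 - e) = 0 := by
    apply hu.mul_left_eq_zero.1
    calc (1 - x) * (1 - e) * u = (1 - x) * (u - e * u) := by noncomm_ring
      _ = (1 - x) * (x - x * e - (e - e * e)) := by rw [hu', mul_sub e, hc x]; congr 1; abel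
      _ = 0 := by rw [he.eq, h1, sub_zero, sub_self, sub_zero, sub_mul, hx.eq, one_mul, sub_self]
  have h3 : (1 - x) * (1 - e) = 1 - e - x + x * e := by noncomm_ring
  rw [h3, h1, add_zero] at h2
  exact (sub_eq_zero.1 h2).symm

/-- In an abelian ring, the idempotent in a clean decomposition of an element that is idempotent
modulo `I` is determined modulo `I`. -/
theorem IsAbelianRing.mk_eq_one_sub {R : Type*} [Ring R] (hR : IsAbelianRing R) (I : Ideal R)
    [I.IsTwoSided] {a e u : R} (ha : IsIdempotentElem (Ideal.Quotient.mk I a))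
    (he : IsIdempotentElem e) (hu : IsUnit u) (h : a = e + u) :
    Ideal.Quotient.mk I a = Ideal.Quotient.mk I (1 - e) := by
  rw [map_sub, map_one]
  refine ha.eq_one_sub_of_eq_add (he.map _) (fun r => ?_) (hu.map (Ideal.Quotient.mk I))
    (by rw [h, map_add])
  obtain ⟨r, rfl⟩ := Ideal.Quotient.mk_surjective r
  rw [← map_mul, ← map_mul, hR e he]

/-- Modulo a prime ideal, a central idempotent is `0` or `1`. -/
theorem IsPrimeTwoSidedIdeal.mem_or_one_sub_mem {R : Type*} [Ring R] {P : Ideal R}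
    (hP : IsPrimeTwoSidedIdeal P) {e : R} (he : IsIdempotentElem e) (hc : ∀ r, e * r = r * e) :
    e ∈ P ∨ 1 - e ∈ P := by
  have two : ∀ {c : R}, (∀ r, c * r = r * c) → (Ideal.span {c}).IsTwoSided := fun {c} hc =>
    ⟨fun {a} b ha => by
      obtain ⟨r, rfl⟩ := Ideal.mem_span_singleton'.1 ha
      exact Ideal.mem_span_singleton'.2 ⟨r * b, by rw [mul_assoc, ← hc b, mul_assoc]⟩⟩
  refine (hP.le_or_le (Ideal.span {e}) (Ideal.span {1 - e}) (two hc)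
    (two fun r => by rw [sub_mul, mul_sub, hc]; simp) ?_).imp
    (fun h => h (Ideal.mem_span_singleton_self _)) (fun h => h (Ideal.mem_span_singleton_self _))
  rw [Ideal.mul_le]
  intro r hr s hs
  obtain ⟨r, rfl⟩ := Ideal.mem_span_singleton'.1 hr
  obtain ⟨s, rfl⟩ := Ideal.mem_span_singleton'.1 hs
  have : r * e * (s * (1 - e)) = r * s * (e * (1 - e)) := by
    rw [mul_assoc, ← mul_assoc e, hc s]; noncomm_ring
  rw [this, he.mul_one_sub_self, mul_zero]
  exact P.zero_mem

/-! ### Uniquely `π`-clean rings are abelian -/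

/-- The hypotheses on `t` hold for `t = e r (1 - e)` and for `t = (1 - e) r e`. They make `e + t`
idempotent and `2 e - 1 + t` an involution, so that `e = (1 - (e + t)) + (2 e - 1 + t)` competes
with the decomposition `e = (1 - e) + (2 e - 1)`. -/
theorem eq_zero_of_isUniquelyCleanElem {R : Type*} [Ring R] {e t : R} (he : IsIdempotentElem e)
    (hu : IsUniquelyCleanElem e) (h1 : e * t + t * e = t) (h2 : t * t = 0) : t = 0 := by
  have hf : IsIdempotentElem (e + t) := by
    have : (e + t) * (e + t) = e * e + (e * t + t * e) + t * t := by noncomm_ring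
    rw [IsIdempotentElem, this, he.eq, h1, h2, add_zero]
  have hv : (2 * e - 1 + t) * (2 * e - 1 + t) = 1 := by
    have : (2 * e - 1 + t) * (2 * e - 1 + t) =
        4 * (e * e) - 4 * e + 1 + 2 * (e * t + t * e) - 2 * t + t * t := by noncomm_ring
    rw [this, he.eq, h1, h2]; noncomm_ring
  have h := hu.unique (y₁ := (1 - e, 2 * e - 1)) (y₂ := (1 - (e + t), 2 * e - 1 + t))
    ⟨he.one_sub, he.isUnit_two_mul_sub_one, by noncomm_ring⟩
    ⟨hf.one_sub, isUnit_iff_exists.2 ⟨_, hv, hv⟩, by noncomm_ring⟩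
  simpa using congrArg Prod.snd h

theorem IsUniquelyPiCleanRing.isAbelianRing {R : Type*} [Ring R] (hR : IsUniquelyPiCleanRing R) :
    IsAbelianRing R := by
  intro e he r
  have hu : IsUniquelyCleanElem e := by
    obtain ⟨n, hn, h⟩ := hR e
    obtain ⟨n, rfl⟩ := Nat.exists_eq_succ_of_ne_zero hn.ne'
    rwa [he.pow_succ_eq] at h
  have h1 : e * r * (1 - e) = 0 := by
    refine eq_zero_of_isUniquelyCleanElem he hu ?_ ?_
    · rw [mul_assoc (e * r), he.one_sub_mul_self, mul_zero, add_zero, ← mul_assoc, ← mul_assoc,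
        he.eq]
    · rw [mul_assoc e, mul_assoc, ← mul_assoc _ e, mul_assoc r, he.one_sub_mul_self]; simp
  have h2 : (1 - e) * r * e = 0 := by
    refine eq_zero_of_isUniquelyCleanElem he hu ?_ ?_
    · rw [← mul_assoc, ← mul_assoc, he.mul_one_sub_self, mul_assoc _ e, he.eq]; simp
    · rw [mul_assoc _ e, mul_assoc (1 - e), ← mul_assoc e, ← mul_assoc e, he.mul_one_sub_self]
      simp
  have h1' : e * r = e * r * e := by rwa [mul_sub, mul_one, sub_eq_zero] at h1
  have h2' : r * e = e * r * e := by rwa [sub_mul, sub_mul, one_mul, sub_eq_zero] at h2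
  rw [h1', ← h2']

/-! ### Abelian rings whose elements have clean powers -/

/-- A ring is `π`-clean if every element has a positive power that is the sum of an idempotent and
a unit. -/
def IsPiCleanRing (R : Type*) [Ring R] : Prop :=
  ∀ a : R, ∃ n : ℕ, 0 < n ∧ ∃ e u : R, IsIdempotentElem e ∧ IsUnit u ∧ a ^ n = e + u

theorem IsUniquelyPiCleanRing.isPiCleanRing {R : Type*} [Ring R]
    (hR : IsUniquelyPiCleanRing R) : IsPiCleanRing R := fun a => by
  obtain ⟨n, hn, ⟨e, u⟩, h, -⟩ := hR a
  exact ⟨n, hn, e, u, h⟩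

/-- In a `π`-clean ring, an element `x` lies in the Jacobson radical if no `y x` acts as a left
identity on a nonzero idempotent `f`; for central `f` this says that `x` is left invertible on no
nonzero corner. -/
theorem IsPiCleanRing.mem_jacobson_of_forall_corner {R : Type*} [Ring R] (hc : IsPiCleanRing R)
    {x : R} (h : ∀ f y : R, IsIdempotentElem f → y * x * f = f → f = 0) : x ∈ Ring.jacobson R := by
  refine mem_ring_jacobson_iff.2 fun y => ?_
  obtain ⟨n, hn, e, u, he, ⟨u, rfl⟩, hb⟩ := hc (-(y * x))
  -- The power `(-(y x)) ^ n` agrees with `u` on the corner of `1 - e`, so this corner vanishes.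
  have he1 : 1 - e = 0 := by
    apply h (1 - e) (↑u⁻¹ * (-(y * x)) ^ (n - 1) * (-y)) he.one_sub
    calc ↑u⁻¹ * (-(y * x)) ^ (n - 1) * (-y) * x * (1 - e)
        = ↑u⁻¹ * ((-(y * x)) ^ (n - 1) * (-(y * x))) * (1 - e) := by
          simp only [mul_assoc, neg_mul]
      _ = ↑u⁻¹ * (e * (1 - e)) + ↑u⁻¹ * u * (1 - e) := by
          rw [← pow_succ, Nat.sub_add_cancel hn, hb]; noncomm_ring
      _ = 1 - e := by rw [he.mul_one_sub_self]; simp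
  have hu : (-(y * x)) ^ n - 1 = u := by rw [hb, ← sub_eq_zero.1 he1]; abel
  refine ⟨-(↑u⁻¹ * ∑ i ∈ Finset.range n, (-(y * x)) ^ i), ?_⟩
  have := geom_sum_mul (-(y * x)) n
  calc -(↑u⁻¹ * ∑ i ∈ Finset.range n, (-(y * x)) ^ i) * (y * x + 1)
      = ↑u⁻¹ * ((∑ i ∈ Finset.range n, (-(y * x)) ^ i) * (-(y * x) - 1)) := by noncomm_ring
    _ = 1 := by rw [this, hu, Units.inv_mul]

theorem IsPiCleanRing.idempotentsLiftModulo {R : Type*} [Ring R] (hc : IsPiCleanRing R)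
    (hR : IsAbelianRing R) (I : Ideal R) [I.IsTwoSided] : IdempotentsLiftModulo I := by
  intro x hx
  obtain ⟨a, rfl⟩ := Ideal.Quotient.mk_surjective x
  obtain ⟨n, hn, e, u, he, hu, h⟩ := hc a
  have hp : Ideal.Quotient.mk I (a ^ n) = Ideal.Quotient.mk I a := by
    obtain ⟨n, rfl⟩ := Nat.exists_eq_succ_of_ne_zero hn.ne'
    rw [map_pow, hx.pow_succ_eq]
  exact ⟨1 - e, he.one_sub, by rw [← hR.mk_eq_one_sub I (hp ▸ hx) he hu h, hp]⟩

/-- An abelian `π`-clean ring with zero Jacobson radical is reduced. -/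
theorem IsPiCleanRing.isReduced {R : Type*} [Ring R] (hc : IsPiCleanRing R)
    (hR : IsAbelianRing R) (hJ : Ring.jacobson R = ⊥) : IsReduced R := by
  refine ⟨fun x ⟨m, hm⟩ => ?_⟩
  rw [← Ideal.mem_bot, ← hJ]
  refine hc.mem_jacobson_of_forall_corner fun f y hf h => ?_
  have : ∀ k, y ^ k * x ^ k * f = f := by
    intro k
    induction k with
    | zero => simp
    | succ k ih =>
      calc y ^ (k + 1) * x ^ (k + 1) * f = y ^ k * (y * (x ^ (k + 1) * f)) := by
            rw [pow_succ y]; noncomm_ring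
        _ = y ^ k * (y * x * f) * x ^ k := by
            rw [pow_succ', mul_assoc x, ← hR f hf (x ^ k)]; noncomm_ring
        _ = f := by rw [h, mul_assoc, hR f hf (x ^ k), ← mul_assoc, ih]
  rw [← this m, hm]; simp

/-- A uniquely clean unit `v` is congruent to `1` modulo the radical: if `v - 1` were invertible on
a nonzero corner `f`, then `v = 0 + v = f + (v - f)` would be two clean decompositions. -/
theorem sub_one_mem_jacobson_of_isUniquelyCleanElem {R : Type*} [Ring R] (hc : IsPiCleanRing R)
    (hR : IsAbelianRing R) (v : Rˣ) (hv : IsUniquelyCleanElem (v : R)) :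
    (v : R) - 1 ∈ Ring.jacobson R := by
  refine hc.mem_jacobson_of_forall_corner fun f y hf h => ?_
  have h' := hR.mul_mul_eq_of_mul_mul_eq hf h
  have hu : IsUnit ((v : R) - f) := by
    refine isUnit_iff_exists.2 ⟨y * f + ↑v⁻¹ * (1 - f), ?_, ?_⟩
    · calc ((v : R) - f) * (y * f + ↑v⁻¹ * (1 - f))
          = v * y * f - f * y * f + v * ↑v⁻¹ * (1 - f) - f * ↑v⁻¹ * (1 - f) := by noncomm_ring
        _ = (v - 1) * y * f + (1 - f) := by
          rw [hR f hf y, hR f hf, mul_assoc y, mul_assoc _ f, hf.eq, hf.mul_one_sub_self,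
            Units.mul_inv]
          noncomm_ring
        _ = 1 := by rw [h', add_sub_cancel]
    · calc (y * f + ↑v⁻¹ * (1 - f)) * ((v : R) - f)
          = y * (f * v) - y * (f * f) + ↑v⁻¹ * v - ↑v⁻¹ * (f * v) - ↑v⁻¹ * (f - f * f) := by
            noncomm_ring
        _ = y * (v - 1) * f + (1 - ↑v⁻¹ * v * f) := by
          rw [hR f hf v, hf.eq, Units.inv_mul]
          simp only [← mul_assoc, Units.inv_mul]
          noncomm_ring
        _ = 1 := by rw [h, Units.inv_mul, one_mul, add_sub_cancel]
  have := hv.unique (y₁ := (0, (v : R))) (y₂ := (f, (v : R) - f))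
    ⟨IsIdempotentElem.zero, v.isUnit, by simp⟩ ⟨hf, hu, by simp⟩
  exact (congrArg Prod.fst this).symm

/-! ### Potency of elements modulo the radical -/

/-- If `a ^ n = e + u` with `e` a central idempotent and `u ^ k = 1`, then `a ^ n` is a `k`-th root
of unity on the corner of `1 - e` and `a ^ n - 1` is one on the corner of `e`. -/
theorem pow_sub_one_mul_pow_sub_one_eq_zero {T : Type*} [Ring T] {x e u : T} {k : ℕ}
    (he : IsIdempotentElem e) (hc : ∀ r, e * r = r * e) (hu : u ^ k = 1) (h : x = e + u) :
    (x ^ k - 1) * ((x - 1) ^ k - 1) = 0 := by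
  have pow_mul : ∀ {c f : T}, (∀ r, f * r = r * f) → c * f = u * f → ∀ j, c ^ j * f = u ^ j * f := by
    intro c f hf hcf j
    induction j with
    | zero => simp
    | succ j ih => rw [pow_succ, mul_assoc, hcf, ← hf, ← mul_assoc, ih, mul_assoc, hf, ← mul_assoc,
        ← pow_succ]
  have h1 : (x ^ k - 1) * (1 - e) = 0 := by
    rw [sub_mul, pow_mul (c := x) (fun r => by rw [sub_mul, mul_sub, hc]; simp), hu, sub_self]
    rw [h, add_mul, he.mul_one_sub_self, zero_add]
  have h2 : ((x - 1) ^ k - 1) * e = 0 := by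
    rw [sub_mul, pow_mul (c := x - 1) hc, hu, sub_self]
    rw [h, sub_mul, add_mul, he.eq, one_mul, add_sub_cancel_left]
  calc (x ^ k - 1) * ((x - 1) ^ k - 1)
      = (x ^ k - 1) * (e * ((x - 1) ^ k - 1)) +
          (x ^ k - 1) * (1 - e) * ((x - 1) ^ k - 1) := by noncomm_ring
    _ = 0 := by rw [hc, h1, h2, mul_zero, zero_mul, add_zero]

/-- An element that is integral over a ring of positive characteristic has only finitely many
distinct powers. -/
theorem IsIntegral.exists_pow_eq_pow {T : Type*} [Ring T] {M : ℕ} [NeZero M] [Algebra (ZMod M) T]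
    {a : T} (ha : IsIntegral (ZMod M) a) : ∃ i d : ℕ, 0 < d ∧ a ^ i = a ^ (i + d) := by
  have := Algebra.finite_adjoin_simple_of_isIntegral ha
  have : Finite (Algebra.adjoin (ZMod M) {a}) := Module.finite_of_finite (ZMod M)
  let b : Algebra.adjoin (ZMod M) {a} := ⟨a, Algebra.self_mem_adjoin_singleton _ a⟩
  obtain ⟨i, j, hij, h⟩ := Finite.exists_ne_map_eq_of_infinite (fun i : ℕ => b ^ i)
  have h' : a ^ i = a ^ j := congrArg Subtype.val h
  rcases lt_or_gt_of_ne hij with hlt | hlt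
  · exact ⟨i, j - i, by omega, by rwa [Nat.add_sub_cancel' hlt.le]⟩
  · exact ⟨j, i - j, by omega, by rw [Nat.add_sub_cancel' hlt.le, h']⟩

open Polynomial in
/-- A reduced abelian ring in which powers are sums of idempotents and roots of unity consists of
potent elements. -/
theorem exists_eq_pow_succ {T : Type*} [Ring T] [IsReduced T] (hT : IsAbelianRing T)
    (h : ∀ a : T, ∃ n k : ℕ, 0 < n ∧ 0 < k ∧
      ∃ e u : T, IsIdempotentElem e ∧ u ^ k = 1 ∧ a ^ n = e + u) (a : T) :
    ∃ d : ℕ, 0 < d ∧ a ^ (d + 1) = a := by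
  have root : ∀ a : T, ∃ n k : ℕ, 0 < n ∧ 0 < k ∧
      ((a ^ n) ^ k - 1) * ((a ^ n - 1) ^ k - 1) = 0 := by
    intro a
    obtain ⟨n, k, hn, hk, e, u, he, hu, hau⟩ := h a
    exact ⟨n, k, hn, hk, pow_sub_one_mul_pow_sub_one_eq_zero he (hT e he) hu hau⟩
  -- At `a = 2` and `n = 1` the polynomial would vanish already in `ℤ`; at `3` it never does.
  have hchar : ∃ M : ℕ, M ≠ 0 ∧ (M : T) = 0 := by
    obtain ⟨n, k, hn, hk, h3⟩ := root 3
    have hn3 : 3 ≤ 3 ^ n := Nat.le_self_pow hn.ne' 3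
    have h3k : 1 < (3 ^ n) ^ k := Nat.one_lt_pow hk.ne' (by omega)
    have h2k : 1 < (3 ^ n - 1) ^ k := Nat.one_lt_pow hk.ne' (by omega)
    refine ⟨((3 ^ n) ^ k - 1) * ((3 ^ n - 1) ^ k - 1), ?_, ?_⟩
    · exact Nat.mul_ne_zero (by omega) (by omega)
    · rw [Nat.cast_mul, Nat.cast_sub h3k.le, Nat.cast_sub h2k.le, Nat.cast_pow, Nat.cast_pow,
        Nat.cast_pow, Nat.cast_sub (by omega)]
      simpa using h3
  obtain ⟨M, hM0, hM⟩ := hchar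
  have : NeZero (ringChar T) :=
    ⟨fun h0 => hM0 (by simpa [h0] using (ringChar.spec T M).1 hM)⟩
  let : Algebra (ZMod (ringChar T)) T := ZMod.algebra T (ringChar T)
  have hint : IsIntegral (ZMod (ringChar T)) a := by
    obtain ⟨n, k, hn, hk, ha⟩ := root a
    nontriviality T
    have : Nontrivial (ZMod (ringChar T)) := (algebraMap (ZMod (ringChar T)) T).domain_nontrivial
    have m1 : ((X ^ n) ^ k - 1 : (ZMod (ringChar T))[X]).Monic := by
      rw [← pow_mul, ← C_1]; exact monic_X_pow_sub_C 1 (Nat.mul_ne_zero hn.ne' hk.ne')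
    have m2 : ((X ^ n - 1) ^ k - 1 : (ZMod (ringChar T))[X]).Monic := by
      have m : (X ^ n - C 1 : (ZMod (ringChar T))[X]).Monic := monic_X_pow_sub_C 1 hn.ne'
      rw [← C_1]
      refine (m.pow k).sub_of_left (lt_of_le_of_lt degree_C_le ?_)
      rw [degree_eq_natDegree (m.pow k).ne_zero, m.natDegree_pow, natDegree_X_pow_sub_C]
      exact_mod_cast Nat.mul_pos hk hn
    refine ⟨_, m1.mul m2, ?_⟩
    rw [← aeval_def]
    simpa using ha
  obtain ⟨i, d, hd, hi⟩ := hint.exists_pow_eq_pow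
  refine ⟨d, hd, sub_eq_zero.1 (IsReduced.eq_zero _ ⟨i + 1, ?_⟩)⟩
  have hcomm : Commute a (a ^ d - 1) := ((Commute.refl a).pow_right d).sub_right (.one_right a)
  have : a ^ (d + 1) - a = a * (a ^ d - 1) := by rw [pow_succ', mul_sub, mul_one]
  rw [this, hcomm.mul_pow, pow_succ a, pow_succ' (a ^ d - 1)]
  have h0 : a ^ i * (a ^ d - 1) = 0 := by rw [mul_sub, ← pow_add, ← hi, mul_one, sub_self]
  calc a ^ i * a * ((a ^ d - 1) * (a ^ d - 1) ^ i)
      = a ^ i * (a * (a ^ d - 1)) * (a ^ d - 1) ^ i := by noncomm_ring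
    _ = 0 := by rw [hcomm.eq, ← mul_assoc, h0, zero_mul, zero_mul]

theorem IsUniquelyPiCleanRing.isTorsionRing_quotient {R : Type*} [Ring R]
    (hR : IsUniquelyPiCleanRing R) (P : Ideal R) [P.IsTwoSided] (hP : IsPrimeTwoSidedIdeal P)
    (hJP : Ring.jacobson R ≤ P) : IsTorsionRing (R ⧸ P) := by
  have hab := hR.isAbelianRing
  have hc := hR.isPiCleanRing
  have hlift := hc.idempotentsLiftModulo hab (Ring.jacobson R)
  let π := Ideal.Quotient.mk (Ring.jacobson R)
  have hπ : Function.Surjective π := Ideal.Quotient.mk_surjective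
  have habT : IsAbelianRing (R ⧸ Ring.jacobson R) := by
    intro e he r
    obtain ⟨e, he', rfl⟩ := hlift e he
    obtain ⟨r, rfl⟩ := hπ r
    rw [← map_mul, hab e he', map_mul]
  have hT : ∀ a : R ⧸ Ring.jacobson R, ∃ n k : ℕ, 0 < n ∧ 0 < k ∧
      ∃ e u, IsIdempotentElem e ∧ u ^ k = 1 ∧ a ^ n = e + u := by
    intro a
    obtain ⟨a, rfl⟩ := hπ a
    obtain ⟨n, hn, e, _, he, ⟨u, rfl⟩, h⟩ := hc a
    obtain ⟨k, hk, hu⟩ := hR u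
    have hu1 := sub_one_mem_jacobson_of_isUniquelyCleanElem hc hab (u ^ k) (by simpa using hu)
    refine ⟨n, k, hn, hk, π e, π u, he.map π, ?_, by rw [← map_pow, h, map_add]⟩
    rw [← map_pow, ← map_one π]
    exact (Ideal.Quotient.mk_eq_mk_iff_sub_mem _ _).2 (by simpa using hu1)
  have hcT : IsPiCleanRing (R ⧸ Ring.jacobson R) := fun a => by
    obtain ⟨n, k, hn, hk, e, u, he, hu, h⟩ := hT a
    exact ⟨n, hn, e, u, he, IsUnit.of_pow_eq_one hu hk.ne', h⟩
  have := hcT.isReduced habT (Ring.jacobson_quotient_jacobson R)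
  intro x hx
  obtain ⟨a, rfl⟩ := Ideal.Quotient.mk_surjective x
  obtain ⟨d, hd, had⟩ := exists_eq_pow_succ habT hT (π a)
  have hidem : IsIdempotentElem (π a ^ d) := by
    obtain ⟨d, rfl⟩ := Nat.exists_eq_succ_of_ne_zero hd.ne'
    rw [IsIdempotentElem, ← pow_add, show d.succ + d.succ = d + (d.succ + 1) by omega, pow_add, had,
      pow_succ]
  obtain ⟨e, he, hea⟩ := hlift _ hidem
  have toP : ∀ {b c : R}, π b = π c → Ideal.Quotient.mk P b = Ideal.Quotient.mk P c := fun h =>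
    (Ideal.Quotient.mk_eq_mk_iff_sub_mem _ _).2
      (hJP ((Ideal.Quotient.mk_eq_mk_iff_sub_mem _ _).1 h))
  have heP := toP (hea.trans (map_pow π a d).symm)
  have haP := toP ((map_pow π a _).trans had)
  refine ⟨d, hd, ?_⟩
  rw [← map_pow, ← heP]
  rcases hP.mem_or_one_sub_mem he (hab e he) with h | h
  · refine absurd ?_ hx
    rw [← haP, pow_succ, map_mul, ← heP, Ideal.Quotient.eq_zero_iff_mem.2 h, zero_mul]
  · rw [← map_one (Ideal.Quotient.mk P), eq_comm]
    exact (Ideal.Quotient.mk_eq_mk_iff_sub_mem _ _).2 h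

/-! ### Uniform exponents over all prime ideals -/

/-- Every maximal left ideal contains a prime ideal that contains the radical, namely the primitive
ideal annihilating the corresponding simple module. -/
theorem Ideal.IsMaximal.exists_isPrimeTwoSidedIdeal_le {R : Type*} [Ring R] {m : Ideal R}
    (hm : m.IsMaximal) :
    ∃ P : Ideal R, IsPrimeTwoSidedIdeal P ∧ Ring.jacobson R ≤ P ∧ P ≤ m := by
  let P : Ideal R :=
    { carrier := {r | ∀ s, r * s ∈ m}
      add_mem' := fun ha hb s => by rw [add_mul]; exact m.add_mem (ha s) (hb s)
      zero_mem' := fun s => by rw [zero_mul]; exact m.zero_mem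
      smul_mem' := fun c x hx s => by
        rw [smul_eq_mul, mul_assoc]; exact m.mul_mem_left c (hx s) }
  have mem : ∀ {r}, r ∈ P ↔ ∀ s, r * s ∈ m := Iff.rfl
  have hle : P ≤ m := fun r hr => by simpa using mem.1 hr 1
  have hP : P.IsTwoSided := ⟨fun b ha s => by rw [mul_assoc]; exact ha _⟩
  refine ⟨P, ⟨hP, fun h => hm.ne_top (top_le_iff.1 (h ▸ hle)), fun K L hK hL hKL => ?_⟩,
    fun r hr s => ?_, hle⟩
  · refine or_iff_not_imp_right.2 fun hLP => ?_
    have hLm : ¬ L ≤ m := fun h => hLP fun x hx s => h (L.mul_mem_right s hx)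
    obtain ⟨r, hr⟩ := Set.not_subset.1 hLm
    -- As `L + m = R`, also `K R ⊆ K L + K m ⊆ m`.
    have htop : L ⊔ m = ⊤ :=
      hm.1.2 _ (lt_of_le_of_ne le_sup_right fun h => hLm (h ▸ le_sup_left))
    intro x hx s
    obtain ⟨l, hl, t, ht, rfl⟩ := Submodule.mem_sup.1 (htop ▸ Submodule.mem_top (x := s))
    rw [mul_add]
    exact m.add_mem (hle (hKL (Ideal.mul_mem_mul hx hl))) (m.mul_mem_left x ht)
  · exact Ring.jacobson_le_of_isMaximal m (Ideal.mul_mem_right s _ hr)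

theorem Ideal.IsTwoSided.sup {R : Type*} [Ring R] {K L : Ideal R} (hK : K.IsTwoSided)
    (hL : L.IsTwoSided) : (K ⊔ L).IsTwoSided := by
  refine ⟨fun b hx => ?_⟩
  obtain ⟨k, hk, l, hl, rfl⟩ := Submodule.mem_sup.1 hx
  rw [add_mul]
  exact Submodule.add_mem_sup (K.mul_mem_right b hk) (L.mul_mem_right b hl)

theorem Ideal.pow_succ_sub_pow_mem {R : Type*} [Ring R] {I : Ideal R} [I.IsTwoSided] {a : R}
    {d k : ℕ} (h : (a ^ (d + 1) - a) ^ k ∈ I) (c : ℕ) : (a ^ (d * c + 1) - a) ^ k ∈ I := by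
  have hs : Commute a (∑ i ∈ Finset.range c, (a ^ d) ^ i) :=
    Commute.sum_right _ _ _ fun i _ => ((Commute.refl a).pow_right d).pow_right i
  have hfac : a ^ (d * c + 1) - a = (a ^ (d + 1) - a) * ∑ i ∈ Finset.range c, (a ^ d) ^ i := by
    rw [pow_succ' a d, pow_succ', pow_mul, ← mul_sub_one, ← mul_sub_one, mul_assoc, mul_geom_sum]
  rw [hfac, ((hs.pow_left _).sub_left hs).mul_pow]
  exact I.mul_mem_right _ h

/-- If every prime quotient over `J` is torsion, then one exponent `d` works for all these primes at
once. Otherwise an ideal maximal among those that contain no power of any `a ^ (d + 1) - a` would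
be prime, while `a` is `0` or a root of unity modulo any prime. -/
theorem exists_pow_succ_sub_pow_mem {R : Type*} [Ring R] (J : Ideal R) [hJ : J.IsTwoSided]
    (h : ∀ (P : Ideal R) [P.IsTwoSided], IsPrimeTwoSidedIdeal P → J ≤ P → IsTorsionRing (R ⧸ P))
    (a : R) : ∃ d k : ℕ, 0 < d ∧ (a ^ (d + 1) - a) ^ k ∈ J := by
  by_contra! hcon
  obtain ⟨P, hJP, hP⟩ := zorn_le_nonempty₀
    {I : Ideal R | I.IsTwoSided ∧ ∀ d k : ℕ, 0 < d → (a ^ (d + 1) - a) ^ k ∉ I} (by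
      intro c hc hchain I hI
      have hmem := fun z => Submodule.mem_sSup_of_directed (z := z) ⟨I, hI⟩ hchain.directedOn
      refine ⟨sSup c, ⟨⟨fun {x} b hx => ?_⟩, fun d k hd hx => ?_⟩, fun _ => le_sSup⟩
      · obtain ⟨K, hK, hxK⟩ := (hmem x).1 hx
        exact (hmem _).2 ⟨K, hK, (hc hK).1.mul_mem_of_left b hxK⟩
      · obtain ⟨K, hK, hxK⟩ := (hmem _).1 hx
        exact (hc hK).2 d k hd hxK) J ⟨hJ, hcon⟩
  obtain ⟨⟨hP2, hPa⟩, hmax⟩ := hP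
  have grow : ∀ K : Ideal R, K.IsTwoSided → ¬ K ≤ P →
      ∃ d k : ℕ, 0 < d ∧ (a ^ (d + 1) - a) ^ k ∈ K ⊔ P := by
    intro K hK hKP
    by_contra! hcon'
    exact hKP (le_sup_left.trans (hmax ⟨hK.sup hP2, hcon'⟩ le_sup_right))
  have hprime : IsPrimeTwoSidedIdeal P := by
    refine ⟨hP2, fun htop => hPa 1 0 one_pos (htop ▸ Submodule.mem_top), fun K L hK hL hKL => ?_⟩
    by_contra! hcon'
    obtain ⟨d, k, hd, h1⟩ := grow K hK hcon'.1
    obtain ⟨d', k', hd', h2⟩ := grow L hL hcon'.2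
    have := hK.sup hP2
    have := hL.sup hP2
    have h1' := Ideal.pow_succ_sub_pow_mem h1 d'
    have h2' := Ideal.pow_succ_sub_pow_mem h2 d
    rw [mul_comm d' d] at h2'
    apply hPa (d * d') (k + k') (Nat.mul_pos hd hd')
    rw [pow_add]
    obtain ⟨p, hp, q, hq, hpq⟩ := Submodule.mem_sup.1 h1'
    obtain ⟨r, hr, s, hs, hrs⟩ := Submodule.mem_sup.1 h2'
    rw [← hpq, ← hrs, add_mul, mul_add]
    exact P.add_mem (P.add_mem (hKL (Ideal.mul_mem_mul hp hr)) (P.mul_mem_left p hs))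
      (P.mul_mem_right _ hq)
  by_cases ha : Ideal.Quotient.mk P a = 0
  · refine hPa 1 1 one_pos ?_
    rw [← Ideal.Quotient.eq_zero_iff_mem]
    simp [ha]
  · obtain ⟨d, hd, had⟩ := h P hprime hJP _ ha
    refine hPa d 1 hd ?_
    rw [← Ideal.Quotient.eq_zero_iff_mem]
    simp [pow_succ, had]

theorem mem_jacobson_of_pow_mem {R : Type*} [Ring R]
    (h : ∀ (P : Ideal R) [P.IsTwoSided], IsPrimeTwoSidedIdeal P → Ring.jacobson R ≤ P →
      IsTorsionRing (R ⧸ P)) {x : R} {k : ℕ} (hx : x ^ k ∈ Ring.jacobson R) :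
    x ∈ Ring.jacobson R := by
  rw [Ring.jacobson_eq_sInf_isMaximal, Submodule.mem_sInf]
  intro m hm
  obtain ⟨P, hP, hJP, hPm⟩ := Ideal.IsMaximal.exists_isPrimeTwoSidedIdeal_le hm
  have := hP.isTwoSided
  apply hPm
  by_contra hxP
  obtain ⟨j, hj, hxj⟩ := h P hP hJP (Ideal.Quotient.mk P x) fun h0 =>
    hxP (Ideal.Quotient.eq_zero_iff_mem.1 h0)
  have h1 : Ideal.Quotient.mk P 1 = 0 := by
    calc Ideal.Quotient.mk P 1 = (Ideal.Quotient.mk P x ^ j) ^ k := by rw [hxj, one_pow, map_one]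
      _ = (Ideal.Quotient.mk P (x ^ k)) ^ j := by rw [map_pow, ← pow_mul, ← pow_mul, mul_comm]
      _ = 0 := by rw [Ideal.Quotient.eq_zero_iff_mem.2 (hJP hx), zero_pow hj.ne']
  exact hP.ne_top ((Ideal.eq_top_iff_one P).2 (Ideal.Quotient.eq_zero_iff_mem.1 h1))

/-- In an abelian ring, an element congruent to an idempotent modulo the radical is uniquely
clean. -/
theorem IsAbelianRing.isUniquelyCleanElem {R : Type*} [Ring R] (hR : IsAbelianRing R) {a g : R}
    (hg : IsIdempotentElem g) (h : a - g ∈ Ring.jacobson R) : IsUniquelyCleanElem a := by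
  refine ⟨(1 - g, 2 * g - 1 + (a - g)),
    ⟨hg.one_sub, hg.isUnit_two_mul_sub_one.add_mem_jacobson h, by noncomm_ring⟩, ?_⟩
  rintro ⟨e, u⟩ ⟨he, hu, hau⟩
  have hmk : Ideal.Quotient.mk (Ring.jacobson R) a = Ideal.Quotient.mk (Ring.jacobson R) g :=
    (Ideal.Quotient.mk_eq_mk_iff_sub_mem _ _).2 h
  have hge : g = 1 - e := by
    refine hR.eq_of_sub_mem_jacobson hg he.one_sub ?_
    rw [← Ideal.Quotient.mk_eq_mk_iff_sub_mem, ← hmk]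
    exact hR.mk_eq_one_sub _ (hmk ▸ hg.map _) he hu hau
  dsimp only at hau
  rw [hge, hau]
  ext
  · simp
  · dsimp only; noncomm_ring

theorem theorem3p3 {R : Type*} [Ring R] :
    IsUniquelyPiCleanRing R ↔
      IsAbelianRing R ∧
      IdempotentsLiftModulo (Ring.jacobson R) ∧
      ∀ (P : Ideal R) [P.IsTwoSided], IsPrimeTwoSidedIdeal P → Ring.jacobson R ≤ P →
        IsTorsionRing (R ⧸ P) := by
  refine ⟨fun hR => ⟨hR.isAbelianRing,
    hR.isPiCleanRing.idempotentsLiftModulo hR.isAbelianRing _,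
    fun P _ hP hJP => hR.isTorsionRing_quotient P hP hJP⟩, ?_⟩
  rintro ⟨hR, hlift, hP⟩ a
  obtain ⟨d, k, hd, hk⟩ := exists_pow_succ_sub_pow_mem (Ring.jacobson R) hP a
  have hda := mem_jacobson_of_pow_mem hP hk
  have hidem : IsIdempotentElem (Ideal.Quotient.mk (Ring.jacobson R) (a ^ d)) := by
    rw [IsIdempotentElem, ← map_mul, Ideal.Quotient.mk_eq_mk_iff_sub_mem]
    obtain ⟨d, rfl⟩ := Nat.exists_eq_succ_of_ne_zero hd.ne'
    have : a ^ d.succ * a ^ d.succ - a ^ d.succ = a ^ d * (a ^ (d.succ + 1) - a) := by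
      rw [mul_sub, ← pow_add, ← pow_add, ← pow_succ]; congr 2; omega
    rw [this]
    exact Ideal.mul_mem_left _ _ hda
  obtain ⟨g, hg, hga⟩ := hlift _ hidem
  exact ⟨d, hd, hR.isUniquelyCleanElem hg
    ((Ideal.Quotient.mk_eq_mk_iff_sub_mem _ _).1 hga.symm)⟩
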